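/- Setting. Let $\mathbb V$ be a totally ordered set of router identifiers and $\kappa$ a totally ordered set of community values. An edge is a pair $(i,j)\in\mathbb V\times\mathbb V$; a path is a finite sequence of contiguous edges, $[\,]$ being the trivial path; a path is simple if it visits no router twice; $\mathbb P$ is the set of simple paths together with $\bot$ (no path). The edge $(i,j)$ can extend a path $p$ if $p=[\,]$ or $p$ starts at $j$, and moreover $i\ne j$ and $i\notin p$. A raw routing algebra $(S,\oplus,E,\overline 0,\overline\infty,f^\infty)$ consists of a set $S$ of path-weights, an operation $\oplus:S\times S\to S$, sets $E_{ij}$ of functions $S\to S$ for all edges $(i,j)$, elements $\overline 0,\overline\infty\in S$ and functions $f^\infty_{ij}\in E_{ij}$. It is a *routing algebra* if $\oplus$ is selective ($x\oplus y\in\{x,y\}$), associative and commutative, $x\oplus\overline 0=\overline 0=\overline 0\oplus x$, $x\oplus\overline\infty=x=\overline\infty\oplus x$, $f(\overline\infty)=\overline\infty$ for all $f\in E_{ij}$, and $f^\infty_{ij}(x)=\overline\infty$. It is a *path algebra* with respect to $path:S\to\mathbb P$ if $x=\overline\infty\Leftrightarrow path(x)=\bot$, $path(\overline 0)=[\,]$,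 and for $f\in E_{ij}$: $path(f(x))=\bot$ if $path(x)=\bot$ or $(i,j)$ cannot extend $path(x)$; otherwise $path(f(x))=(i,j)::path(x)$ unless $f(x)=\overline\infty$. It is *increasing* if $x\oplus f(x)=x$ for all $f\in E_{ij}$ and $x\in S$. Protocol. Let $V\subseteq\mathbb V$ be finite. A topology is a matrix $A$ with $A_{ij}\in E_{ij}$ $(i,j\in V)$. Put $F_A(X)_{ij}=\bigl(\bigoplus_{k} A_{ik}(X_{kj})\bigr)\oplus I_{ij}$ for $X\in S^{V\times V}$, where $I_{ii}=\overline 0$, $I_{ij}=\overline\infty$ for $i\neq j$, and the sum runs over $k\in V$ in increasing order and is bracketed to the right, ending in $\overline\infty$. Times and epochs are natural numbers. A network $N$ assigns a topology $N^e$ to each epoch $e$; for $p\subseteq V$, $A^{ep}_{ij}=N^e_{ij}$ if $i,j\in p$, and $f^\infty_{ij}$ otherwise. A schedule consists of $\alpha(t)\subseteq V$ (active routers), $\beta(t,i,j)\in\mathbb N$ with $\beta(t+1,i,j)\le t$, a monotone epoch function $\eta$, and participants $\pi(e)\subseteq V$; write $\rho(t)=\pi(\eta(t))$. For an initial state $X$,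 $\delta^t(X)_{ij}$ is $I_{ij}$ if $i\notin\rho(t)$; else $X_{ij}$ if $t=0$ or $i\notin\rho(t-1)$; else $\delta^{t-1}(X)_{ij}$ if $i\notin\alpha(t)$; else $F_{A^{\eta(t)\rho(t)}}(L)_{ij}$ with $L_{kj}=\delta^{\beta(t,i,k)}(X)_{kj}$. A period $[t_1,t_2]$ with $\eta(t_1)=\eta(t_2)$ is a *pseudocycle* if each $i\in\rho(t_1)$ has a $t\in[t_1,t_2]$ such that $\beta(t',i,j)\ge t_1$ for all $j$ and all $t'\ge t$, and $i\in\alpha(t')$ for some $t'\in[t,t_2]$. The protocol is *always convergent* if for all $V$ and $N$ there are, for every configuration $(e,p)$ with $e\in\mathbb N$, $p\subseteq V$, a fixed point $X^*_{ep}$ of $F_{A^{ep}}$ and a number $k^*_{ep}\in\mathbb N$ such that for every initial state $X$, every schedule and all $t_1\le t_2$ with $\eta(t_1)=\eta(t_2)$: if $[t_1,t_2]$ contains $k^*_{\eta(t_1)\rho(t_1)}$ successive pseudocycles of positive duration (which may share endpoints), then $\delta^{t_3}(X)=X^*_{\eta(t_1)\rho(t_1)}$ for all $t_3\ge t_2$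 with $\eta(t_3)=\eta(t_2)$. In particular the state reached depends only on the network, the epoch and the participants. The algebra bgpLite. A path-weight is $\mathsf{invalid}$ or $\mathsf{valid}(l,c,p)$ with a local preference $l\in\{0,\dots,2^{32}-1\}$, a finite set $c\subseteq\kappa$ of communities, and a path $p$ whose deflation (the path without its edges of the form $(i,i)$) is simple. $\overline\infty=\mathsf{invalid}$ and $\overline 0=\mathsf{valid}(2^{32}-1,\emptyset,[\,])$. In $x\oplus y$ an invalid argument loses; otherwise the greater local preference wins, then the shorter path, then the lexicographically smaller path; if preferences and paths are equal, then the argument whose community set is smaller in the colexicographic order (in which $\emptyset$ is least) wins. Conditions are generated by "and", "or", "not" from "router $i$ is in the path", "$c$ is among the communities" and "the local preference is $v$", all three false on $\mathsf{invalid}$. Policies are generated by: reject; decrease the preference by $n$ (truncated at $0$); add or delete a community; inflate by $n$ (prepend $n$ copies of the path's source; no effect on $[\,]$); sequential composition; and "if condition then policy". Every policy maps $\mathsf{invalid}$ to $\mathsf{invalid}$. $E_{ij}$ consists, for each policy, of the function that sends $\mathsf{invalid}$ to $\mathsf{invalid}$, sends $\mathsf{valid}(l,c,p)$ to $\mathsf{invalid}$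 if $(i,j)$ cannot extend $p$, and otherwise applies the policy to $\mathsf{valid}(l,c,(i,j)::p)$; $f^\infty_{ij}$ is the function of the policy reject. Finally $path(\mathsf{invalid})=\bot$, and $path(\mathsf{valid}(l,c,p))$ is the deflation of $p$. Theorem. (1) bgpLite is a routing algebra, a path algebra with respect to $path$, and increasing, and its protocol $\delta$ is always convergent. (2) Let the left-biased bgpLite be the same algebra except that $x\oplus y=x$ whenever $x$ and $y$ are valid with equal local preferences and equal paths, whatever their communities. It satisfies the routing algebra axioms when equalities between path-weights are read up to the community sets, it is a path algebra with respect to $path$ and increasing (with genuine equality), and its protocol $\delta$ is always convergent (with genuine equality). (3) $path(\mathsf{valid}(l,c,p))$ is unchanged when $p$ is inflated, and equals $p$ if $p$ is simple. -/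

import Mathlib

namespace DBF

universe u v w

/-! ## Paths -/

/-- Consecutive edges of the list fit together (an edge is a pair of router identifiers). -/
def Contiguous {𝕍 : Type u} (p : List (𝕍 × 𝕍)) : Prop :=
  List.IsChain (fun e e' => e.2 = e'.1) p

/-- The routers visited by a sequence of contiguous edges, in order.
The trivial path `[]` visits no router that it could name. -/
def vertices {𝕍 : Type u} : List (𝕍 × 𝕍) → List 𝕍
  | [] => []
  | (i, j) :: p => i :: j :: p.map Prod.snd

/-- An edge with destination `j` is aligned with the path `p`:
`p` is trivial, or `j` is the source of `p`. -/
def Aligned {𝕍 : Type u} (j : 𝕍) (p : List (𝕍 × 𝕍)) : Prop :=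
  ∀ e ∈ p.head?, e.1 = j

/-- `(i, j) :: p` is a legitimate loop-free extension of `p`: the edge is aligned with `p`, and
the source `i` of the edge is neither its destination nor a router of `p`
(`i ≠ j` only matters when `p` is the trivial path, which then sits at `j`). -/
def CanExtend {𝕍 : Type u} (i j : 𝕍) (p : List (𝕍 × 𝕍)) : Prop :=
  Aligned j p ∧ i ≠ j ∧ i ∉ vertices p

/-- Removal of the self-loop edges `(i, i)`, that is, of consecutive duplicate routers. -/
def deflate {𝕍 : Type u} [DecidableEq 𝕍] (p : List (𝕍 × 𝕍)) : List (𝕍 × 𝕍) :=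
  p.filter (fun e => e.1 ≠ e.2)

/-- Prepend `n` copies of the source of the path to its front (nothing happens to `[]`). -/
def inflate {𝕍 : Type u} (p : List (𝕍 × 𝕍)) (n : ℕ) : List (𝕍 × 𝕍) :=
  match p with
  | [] => []
  | (i, j) :: q => List.replicate n (i, i) ++ (i, j) :: q

theorem contiguous_cons {𝕍 : Type u} {i j : 𝕍} {p : List (𝕍 × 𝕍)} :
    Contiguous ((i, j) :: p) ↔ Aligned j p ∧ Contiguous p := by
  unfold Contiguous Aligned
  rw [List.isChain_cons]
  constructor
  · rintro ⟨h, h'⟩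
    exact ⟨fun e he => (h e he).symm, h'⟩
  · rintro ⟨h, h'⟩
    exact ⟨fun e he => (h e he).symm, h'⟩

theorem vertices_cons {𝕍 : Type u} {i j : 𝕍} {p : List (𝕍 × 𝕍)} (h : Aligned j p) (hp : p ≠ []) :
    vertices ((i, j) :: p) = i :: vertices p := by
  match p, hp with
  | (a, b) :: q, _ =>
    have : a = j := h (a, b) (by simp)
    subst this
    simp [vertices]

theorem nodup_cons {𝕍 : Type u} {i j : 𝕍} {p : List (𝕍 × 𝕍)} (h : CanExtend i j p)
    (hp : (vertices p).Nodup) : (vertices ((i, j) :: p)).Nodup := by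
  by_cases hn : p = []
  · subst hn
    simpa [vertices] using h.2.1
  · rw [vertices_cons h.1 hn]
    exact List.nodup_cons.2 ⟨h.2.2, hp⟩

theorem mem_vertices_of_mem_edge {𝕍 : Type u} {a : 𝕍} {p : List (𝕍 × 𝕍)} :
    a ∈ vertices p → ∃ e ∈ p, a = e.1 ∨ a = e.2 := by
  match p with
  | [] => simp [vertices]
  | (i, j) :: q =>
    intro h
    simp only [vertices, List.mem_cons, List.mem_map] at h
    rcases h with h | h | ⟨e, he, h⟩
    · exact ⟨(i, j), by simp, Or.inl h⟩
    · exact ⟨(i, j), by simp, Or.inr h⟩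
    · exact ⟨e, by simp [he], Or.inr h.symm⟩

theorem mem_vertices {𝕍 : Type u} {a : 𝕍} : ∀ {p : List (𝕍 × 𝕍)}, Contiguous p →
    (∃ e ∈ p, a = e.1 ∨ a = e.2) → a ∈ vertices p
  | [], _, h => by simp at h
  | (i, j) :: q, hc, h => by
    obtain ⟨ha, hq⟩ := contiguous_cons.1 hc
    obtain ⟨e, he, h⟩ := h
    rcases List.mem_cons.1 he with rfl | he
    · rcases h with h | h <;> simp [vertices, h]
    · have hne : q ≠ [] := List.ne_nil_of_mem he
      rw [vertices_cons ha hne]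
      exact List.mem_cons_of_mem _ (mem_vertices hq ⟨e, he, h⟩)

theorem deflate_aligned {𝕍 : Type u} [DecidableEq 𝕍] {k : 𝕍} : ∀ {p : List (𝕍 × 𝕍)},
    Contiguous p → Aligned k p → Aligned k (deflate p)
  | [], _, _ => by simp [Aligned, deflate]
  | (i, j) :: q, hc, h => by
    obtain ⟨ha, hq⟩ := contiguous_cons.1 hc
    have hik : i = k := h (i, j) (by simp)
    by_cases hij : i = j
    · have hd : deflate ((i, j) :: q) = deflate q := by simp [deflate, hij]
      rw [hd]
      exact deflate_aligned hq (by rw [← hik, hij]; exact ha)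
    · intro e he
      simp [deflate, hij] at he
      rw [← he]
      exact hik

theorem deflate_contiguous {𝕍 : Type u} [DecidableEq 𝕍] : ∀ {p : List (𝕍 × 𝕍)},
    Contiguous p → Contiguous (deflate p)
  | [], _ => by simp [Contiguous, deflate]
  | (i, j) :: q, hc => by
    obtain ⟨ha, hq⟩ := contiguous_cons.1 hc
    by_cases hij : i = j
    · have hd : deflate ((i, j) :: q) = deflate q := by simp [deflate, hij]
      rw [hd]
      exact deflate_contiguous hq
    · have hd : deflate ((i, j) :: q) = (i, j) :: deflate q := by simp [deflate, hij]
      rw [hd]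
      exact contiguous_cons.2 ⟨deflate_aligned hq ha, deflate_contiguous hq⟩

theorem deflate_inflate {𝕍 : Type u} [DecidableEq 𝕍] (p : List (𝕍 × 𝕍)) (n : ℕ) :
    deflate (inflate p n) = deflate p := by
  match p with
  | [] => rfl
  | (i, j) :: q => simp [inflate, deflate, List.filter_append]

theorem inflate_contiguous {𝕍 : Type u} {p : List (𝕍 × 𝕍)} (n : ℕ) (hp : Contiguous p) :
    Contiguous (inflate p n) := by
  match p with
  | [] => exact hp
  | (i, j) :: q =>
    induction n with
    | zero => exact hp
    | succ n ih =>
      have h : inflate ((i, j) :: q) (n + 1) = (i, i) :: inflate ((i, j) :: q) n := by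
        simp [inflate, List.replicate_succ]
      rw [h]
      refine contiguous_cons.2 ⟨?_, ih⟩
      intro e he
      cases n with
      | zero =>
        simp [inflate] at he
        rw [← he]
      | succ n =>
        simp [inflate, List.replicate_succ] at he
        rw [← he]

/-- Simple paths: contiguous sequences of edges visiting no router twice. -/
@[ext]
structure SimplePath (𝕍 : Type u) where
  edges : List (𝕍 × 𝕍)
  contiguous : Contiguous edges
  nodup : (vertices edges).Nodup

/-- The set `ℙ`: the simple paths, with `⊥` for the absence of a path. -/
abbrev Paths (𝕍 : Type u) : Type u := WithBot (SimplePath 𝕍)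

/-- The trivial path. -/
def SimplePath.nil {𝕍 : Type u} : SimplePath 𝕍 where
  edges := []
  contiguous := by simp [Contiguous]
  nodup := by simp [vertices]

/-- The path `(i, j) :: p`. -/
def SimplePath.cons {𝕍 : Type u} (i j : 𝕍) (p : SimplePath 𝕍) (h : CanExtend i j p.edges) :
    SimplePath 𝕍 where
  edges := (i, j) :: p.edges
  contiguous := contiguous_cons.2 ⟨h.1, p.contiguous⟩
  nodup := nodup_cons h p.nodup

/-! ## Raw routing algebras and their axioms -/

/-- A raw routing algebra over the router identifiers `𝕍`. -/
structure RawRoutingAlgebra (𝕍 : Type u) where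
  /-- the path-weights -/
  S : Type v
  /-- the choice operator `⊕` -/
  choice : S → S → S
  /-- the policy functions that may be used on the edge `(i, j)` -/
  E : 𝕍 → 𝕍 → Set (S → S)
  /-- the trivial path-weight -/
  zero : S
  /-- the invalid path-weight -/
  inf : S
  /-- the policy that represents a missing edge `(i, j)` -/
  fInf : ∀ i j, E i j

/-- The axioms of a routing algebra, with equality of path-weights read as the relation `r`. -/
structure IsRoutingAlgebraUpTo {𝕍 : Type u} (A : RawRoutingAlgebra.{u, v} 𝕍)
    (r : A.S → A.S → Prop) : Prop where
  choice_sel : ∀ x y, r (A.choice x y) x ∨ r (A.choice x y) y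
  choice_assoc : ∀ x y z, r (A.choice x (A.choice y z)) (A.choice (A.choice x y) z)
  choice_comm : ∀ x y, r (A.choice x y) (A.choice y x)
  zero_annihilator : ∀ x, r (A.choice x A.zero) A.zero ∧ r (A.choice A.zero x) A.zero
  inf_identity : ∀ x, r (A.choice x A.inf) x ∧ r (A.choice A.inf x) x
  inf_fixed : ∀ i j, ∀ f ∈ A.E i j, r (f A.inf) A.inf
  fInf_inf : ∀ i j x, r ((A.fInf i j : A.S → A.S) x) A.inf

/-- A routing algebra. -/
def IsRoutingAlgebra {𝕍 : Type u} (A : RawRoutingAlgebra.{u, v} 𝕍) : Prop :=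
  IsRoutingAlgebraUpTo A (fun x y => x = y)

/-- A path algebra. A policy may always reject a path-weight; a path-weight that is not rejected
has its path extended by the edge. -/
structure IsPathAlgebra {𝕍 : Type u} (A : RawRoutingAlgebra.{u, v} 𝕍)
    (path : A.S → Paths 𝕍) : Prop where
  path_inf : ∀ x, x = A.inf ↔ path x = ⊥
  path_zero : ∀ x, x = A.zero → path x = (SimplePath.nil : SimplePath 𝕍)
  path_absent : ∀ i j, ∀ f ∈ A.E i j, ∀ x, path x = ⊥ → path (f x) = ⊥
  path_reject : ∀ i j, ∀ f ∈ A.E i j, ∀ x, ∀ p : SimplePath 𝕍, path x = p →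
    ¬ CanExtend i j p.edges → path (f x) = ⊥
  path_accept : ∀ i j, ∀ f ∈ A.E i j, ∀ x, ∀ p : SimplePath 𝕍, path x = p →
    ∀ h : CanExtend i j p.edges, f x ≠ A.inf → path (f x) = (SimplePath.cons i j p h)

/-- The preference relation `x ≤_⊕ y`. -/
def Preferred {𝕍 : Type u} (A : RawRoutingAlgebra.{u, v} 𝕍) (x y : A.S) : Prop :=
  A.choice x y = x

/-- An increasing algebra. -/
def IsIncreasing {𝕍 : Type u} (A : RawRoutingAlgebra.{u, v} 𝕍) : Prop :=
  ∀ i j, ∀ f ∈ A.E i j, ∀ x, Preferred A x (f x)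

/-! ## The synchronous protocol

`V` is the finite set of routers that ever participate. -/

/-- Routing states: `X i j` is the path-weight of the current route of `i` to `j`. -/
abbrev State {𝕍 : Type u} (A : RawRoutingAlgebra.{u, v} 𝕍) (V : Finset 𝕍) : Type (max u v) :=
  V → V → A.S

/-- Network topologies: adjacency matrices of policy functions. -/
abbrev Topology {𝕍 : Type u} (A : RawRoutingAlgebra.{u, v} 𝕍) (V : Finset 𝕍) : Type (max u v) :=
  ∀ i j : V, A.E i j

/-- The identity matrix. -/
def identity {𝕍 : Type u} [LinearOrder 𝕍] (A : RawRoutingAlgebra.{u, v} 𝕍) (V : Finset 𝕍) :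
    State A V :=
  fun i j => if i = j then A.zero else A.inf

/-- `⨁ₖ g k`, the sum being taken in increasing order of router identifiers. -/
def bigChoice {𝕍 : Type u} [LinearOrder 𝕍] (A : RawRoutingAlgebra.{u, v} 𝕍) (V : Finset 𝕍)
    (g : V → A.S) : A.S :=
  ((Finset.univ : Finset V).sort (· ≤ ·)).foldr (fun k x => A.choice (g k) x) A.inf

/-- One synchronous round: `F T X = T(X) ⊕ I`. -/
def F {𝕍 : Type u} [LinearOrder 𝕍] {A : RawRoutingAlgebra.{u, v} 𝕍} {V : Finset 𝕍}
    (T : Topology A V) (X : State A V) : State A V :=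
  fun i j => A.choice (bigChoice A V (fun k => (T i k : A.S → A.S) (X k j))) (identity A V i j)

/-! ## The asynchronous protocol

Times and epochs are natural numbers. -/

/-- Dynamic networks: a topology for every epoch. -/
abbrev Network {𝕍 : Type u} (A : RawRoutingAlgebra.{u, v} 𝕍) (V : Finset 𝕍) : Type (max u v) :=
  ℕ → Topology A V

/-- Schedules. -/
structure Schedule {𝕍 : Type u} (V : Finset 𝕍) where
  /-- the activation function -/
  α : ℕ → Set V
  /-- the data flow function -/
  β : ℕ → V → V → ℕ
  /-- the epoch function -/
  η : ℕ → ℕ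
  /-- the participants function -/
  π : ℕ → Set V
  causal : ∀ t i j, β (t + 1) i j ≤ t
  monotone : ∀ t₁ t₂, t₁ ≤ t₂ → η t₁ ≤ η t₂

/-- The participants at time `t`. -/
def Schedule.ρ {𝕍 : Type u} {V : Finset 𝕍} (ψ : Schedule V) (t : ℕ) : Set V := ψ.π (ψ.η t)

open Classical in
/-- The participating topology in epoch `e` with participants `p`. -/
noncomputable def participating {𝕍 : Type u} {A : RawRoutingAlgebra.{u, v} 𝕍} {V : Finset 𝕍}
    (N : Network A V) (e : ℕ) (p : Set V) : Topology A V :=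
  fun i j => if i ∈ p ∧ j ∈ p then N e i j else A.fInf i j

open Classical in
/-- The asynchronous state function. -/
noncomputable def δ {𝕍 : Type u} [LinearOrder 𝕍] {A : RawRoutingAlgebra.{u, v} 𝕍} {V : Finset 𝕍}
    (N : Network A V) (X : State A V) (ψ : Schedule V) : ℕ → State A V
  | 0 => fun i j => if i ∉ ψ.ρ 0 then identity A V i j else X i j
  | t + 1 => fun i j =>
      if i ∉ ψ.ρ (t + 1) then identity A V i j
      else if i ∉ ψ.ρ t then X i j
      else if i ∉ ψ.α (t + 1) then δ N X ψ t i j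
      else F (participating N (ψ.η (t + 1)) (ψ.ρ (t + 1)))
        (fun k l => δ N X ψ (ψ.β (t + 1) i k) k l) i j
termination_by t => t
decreasing_by
  · exact Nat.lt_succ_self t
  · exact Nat.lt_succ_of_le (ψ.causal t i k)

/-- `[t₁, t₂]` is an expiry period for `i`. -/
def Schedule.Expiry {𝕍 : Type u} {V : Finset 𝕍} (ψ : Schedule V) (i : V) (t₁ t₂ : ℕ) : Prop :=
  ψ.η t₁ = ψ.η t₂ ∧ ∀ j t, t₂ ≤ t → t₁ ≤ ψ.β t i j

/-- `[t₁, t₂]` is an activation period for `i`. -/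
def Schedule.Activation {𝕍 : Type u} {V : Finset 𝕍} (ψ : Schedule V) (i : V) (t₁ t₂ : ℕ) : Prop :=
  ψ.η t₁ = ψ.η t₂ ∧ ∃ t, t₁ ≤ t ∧ t ≤ t₂ ∧ i ∈ ψ.α t

/-- `[t₁, t₂]` is a pseudocycle. -/
def Schedule.Pseudocycle {𝕍 : Type u} {V : Finset 𝕍} (ψ : Schedule V) (t₁ t₂ : ℕ) : Prop :=
  ψ.η t₁ = ψ.η t₂ ∧
    ∀ i ∈ ψ.ρ t₁, ∃ t, t₁ ≤ t ∧ t ≤ t₂ ∧ ψ.Expiry i t₁ t ∧ ψ.Activation i t t₂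

/-- `[t₁, t₂]` contains `k` successive pseudocycles `[s m, e m]` of positive duration
(consecutive ones may share an endpoint). -/
def Schedule.ContainsPseudocycles {𝕍 : Type u} {V : Finset 𝕍} (ψ : Schedule V)
    (t₁ t₂ k : ℕ) : Prop :=
  ∃ s e : ℕ → ℕ,
    (∀ m < k, t₁ ≤ s m ∧ s m < e m ∧ e m ≤ t₂ ∧ ψ.Pseudocycle (s m) (e m)) ∧
    (∀ m, m + 1 < k → e m ≤ s (m + 1))

/-- The protocol over the dynamic network `N` is convergent over the set `C` of configurations
(pairs of an epoch and a set of participants). -/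
def Convergent {𝕍 : Type u} [LinearOrder 𝕍] {A : RawRoutingAlgebra.{u, v} 𝕍} {V : Finset 𝕍}
    (N : Network A V) (C : Set (ℕ × Set V)) : Prop :=
  ∃ (Xs : ℕ × Set V → State A V) (k : ℕ × Set V → ℕ),
    (∀ c ∈ C, F (participating N c.1 c.2) (Xs c) = Xs c) ∧
    ∀ (X : State A V) (ψ : Schedule V) (t₁ t₂ : ℕ),
      (ψ.η t₁, ψ.ρ t₁) ∈ C → t₁ ≤ t₂ → ψ.η t₁ = ψ.η t₂ →
      ψ.ContainsPseudocycles t₁ t₂ (k (ψ.η t₁, ψ.ρ t₁)) →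
      ∀ t₃, t₂ ≤ t₃ → ψ.η t₂ = ψ.η t₃ → δ N X ψ t₃ = Xs (ψ.η t₁, ψ.ρ t₁)

/-- The protocol is always convergent: for every finite set of routers and every dynamic network,
over all configurations. -/
def AlwaysConvergent {𝕍 : Type u} [LinearOrder 𝕍] (A : RawRoutingAlgebra.{u, v} 𝕍) : Prop :=
  ∀ (V : Finset 𝕍) (N : Network A V), Convergent N Set.univ

/-! ## The algebra `bgpLite`

`κ` is the type of community values. -/

/-- Local preferences `0, …, 2 ^ 32 - 1`; higher values are preferred. -/
abbrev LocalPref : Type := Fin (2 ^ 32)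

/-- The highest local preference. -/
def LocalPref.highest : LocalPref := ⟨2 ^ 32 - 1, by norm_num⟩

/-- Decrease of a local preference, truncated at `0`. -/
def LocalPref.decrBy (l : LocalPref) (n : ℕ) : LocalPref :=
  ⟨l.val - n, lt_of_le_of_lt (Nat.sub_le _ _) l.isLt⟩

/-- The paths stored in path-weights: contiguous sequences of edges, possibly inflated, whose
deflation is a simple path. -/
@[ext]
structure StoredPath (𝕍 : Type u) [DecidableEq 𝕍] where
  edges : List (𝕍 × 𝕍)
  contiguous : Contiguous edges
  nodup : (vertices (deflate edges)).Nodup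

/-- The empty stored path. -/
def StoredPath.nil {𝕍 : Type u} [DecidableEq 𝕍] : StoredPath 𝕍 where
  edges := []
  contiguous := by simp [Contiguous]
  nodup := by simp [vertices, deflate]

/-- The stored path `(i, j) :: p`. -/
def StoredPath.cons {𝕍 : Type u} [DecidableEq 𝕍] (i j : 𝕍) (p : StoredPath 𝕍)
    (h : CanExtend i j p.edges) : StoredPath 𝕍 where
  edges := (i, j) :: p.edges
  contiguous := contiguous_cons.2 ⟨h.1, p.contiguous⟩
  nodup := by
    have hd : deflate ((i, j) :: p.edges) = (i, j) :: deflate p.edges := by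
      simp [deflate, h.2.1]
    rw [hd]
    refine nodup_cons ⟨deflate_aligned p.contiguous h.1, h.2.1, fun hi => h.2.2 ?_⟩ p.nodup
    obtain ⟨e, he, h'⟩ := mem_vertices_of_mem_edge hi
    exact mem_vertices p.contiguous ⟨e, (List.mem_filter.1 he).1, h'⟩

/-- Inflation of a stored path. -/
def StoredPath.inflate {𝕍 : Type u} [DecidableEq 𝕍] (p : StoredPath 𝕍) (n : ℕ) :
    StoredPath 𝕍 where
  edges := DBF.inflate p.edges n
  contiguous := inflate_contiguous n p.contiguous
  nodup := by
    rw [deflate_inflate]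
    exact p.nodup

/-- Deflation of a stored path. -/
def StoredPath.deflate {𝕍 : Type u} [DecidableEq 𝕍] (p : StoredPath 𝕍) : SimplePath 𝕍 where
  edges := DBF.deflate p.edges
  contiguous := deflate_contiguous p.contiguous
  nodup := p.nodup

/-- Path-weights. -/
inductive PathWeight (𝕍 : Type u) (κ : Type w) [DecidableEq 𝕍] : Type (max u w)
  | invalid : PathWeight 𝕍 κ
  | valid : LocalPref → Finset κ → StoredPath 𝕍 → PathWeight 𝕍 κ

/-- The choice operator: invalid path-weights lose, then the higher local preference wins, then
the shorter stored path, then the lexicographically smaller stored path. If all of these agree,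
`tie cs ds` says whether the left or the right argument is returned. -/
def PathWeight.choice {𝕍 : Type u} {κ : Type w} [LinearOrder 𝕍]
    (tie : Finset κ → Finset κ → Bool) : PathWeight 𝕍 κ → PathWeight 𝕍 κ → PathWeight 𝕍 κ
  | x, .invalid => x
  | .invalid, y => y
  | .valid l cs p, .valid m ds q =>
      if m < l then .valid l cs p
      else if l < m then .valid m ds q
      else if p.edges.length < q.edges.length then .valid l cs p
      else if q.edges.length < p.edges.length then .valid m ds q
      else if p.edges.map toLex < q.edges.map toLex then .valid l cs p
      else if q.edges.map toLex < p.edges.map toLex then .valid m ds q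
      else if tie cs ds then .valid l cs p
      else .valid m ds q

/-- The language of conditions. -/
inductive Condition (𝕍 : Type u) (κ : Type w) : Type (max u w)
  | and : Condition 𝕍 κ → Condition 𝕍 κ → Condition 𝕍 κ
  | or : Condition 𝕍 κ → Condition 𝕍 κ → Condition 𝕍 κ
  | not : Condition 𝕍 κ → Condition 𝕍 κ
  | inPath : 𝕍 → Condition 𝕍 κ
  | inComm : κ → Condition 𝕍 κ
  | hasPref : LocalPref → Condition 𝕍 κ

/-- The semantics of conditions. -/
def Condition.eval {𝕍 : Type u} {κ : Type w} [DecidableEq 𝕍] [DecidableEq κ] :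
    Condition 𝕍 κ → PathWeight 𝕍 κ → Bool
  | .and c d, x => c.eval x && d.eval x
  | .or c d, x => c.eval x || d.eval x
  | .not c, x => !(c.eval x)
  | .inComm c, .valid _ cs _ => decide (c ∈ cs)
  | .inPath i, .valid _ _ p => decide (i ∈ vertices p.edges)
  | .hasPref v, .valid l _ _ => decide (v = l)
  | _, .invalid => false

/-- The policy language. -/
inductive Policy (𝕍 : Type u) (κ : Type w) : Type (max u w)
  | reject : Policy 𝕍 κ
  | decrPrefBy : ℕ → Policy 𝕍 κ
  | addComm : κ → Policy 𝕍 κ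
  | delComm : κ → Policy 𝕍 κ
  | inflate : ℕ → Policy 𝕍 κ
  | seq : Policy 𝕍 κ → Policy 𝕍 κ → Policy 𝕍 κ
  | cond : Condition 𝕍 κ → Policy 𝕍 κ → Policy 𝕍 κ

/-- The semantics of policies. -/
def Policy.apply {𝕍 : Type u} {κ : Type w} [DecidableEq 𝕍] [DecidableEq κ] :
    Policy 𝕍 κ → PathWeight 𝕍 κ → PathWeight 𝕍 κ
  | _, .invalid => .invalid
  | .reject, _ => .invalid
  | .decrPrefBy n, .valid l cs p => .valid (l.decrBy n) cs p
  | .addComm c, .valid l cs p => .valid l (insert c cs) p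
  | .delComm c, .valid l cs p => .valid l (cs.erase c) p
  | .inflate n, .valid l cs p => .valid l cs (p.inflate n)
  | .seq a b, x => b.apply (a.apply x)
  | .cond c a, x => if c.eval x then a.apply x else x

open Classical in
/-- The policy function on the edge `(i, j)` given by a policy: path-weights whose stored path is
not aligned with the edge, or would loop, become invalid; otherwise the path is extended by the
edge and the policy is applied. -/
noncomputable def policyFunction {𝕍 : Type u} {κ : Type w} [DecidableEq 𝕍] [DecidableEq κ]
    (i j : 𝕍) (pol : Policy 𝕍 κ) : PathWeight 𝕍 κ → PathWeight 𝕍 κ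
  | .invalid => .invalid
  | .valid l cs p =>
      if h : CanExtend i j p.edges then pol.apply (.valid l cs (p.cons i j h)) else .invalid

/-- The projection from path-weights to simple paths. -/
def PathWeight.path {𝕍 : Type u} {κ : Type w} [DecidableEq 𝕍] : PathWeight 𝕍 κ → Paths 𝕍
  | .invalid => ⊥
  | .valid _ _ p => (p.deflate : SimplePath 𝕍)

/-- The BGP-like algebra whose choice operator uses `tie` on the remaining ties. -/
noncomputable def bgpLiteWith (𝕍 : Type u) (κ : Type w) [LinearOrder 𝕍] [DecidableEq κ]
    (tie : Finset κ → Finset κ → Bool) : RawRoutingAlgebra.{u, max u w} 𝕍 where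
  S := PathWeight 𝕍 κ
  choice := PathWeight.choice tie
  E := fun i j => Set.range (policyFunction i j)
  zero := .valid LocalPref.highest ∅ StoredPath.nil
  inf := .invalid
  fInf := fun i j => ⟨policyFunction i j .reject, Set.mem_range_self _⟩

/-- The algebra `bgpLite`; the remaining ties are broken by comparing the finite sets of
communities in the colexicographic order, in which `∅` is the least element. -/
noncomputable def bgpLite (𝕍 : Type u) (κ : Type w) [LinearOrder 𝕍] [LinearOrder κ] :
    RawRoutingAlgebra.{u, max u w} 𝕍 :=
  bgpLiteWith 𝕍 κ (fun cs ds => decide (toColex cs ≤ toColex ds))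

/-- The left-biased version of `bgpLite`: on the remaining ties the left argument is returned,
whatever the communities are. -/
noncomputable def bgpLiteLeft (𝕍 : Type u) (κ : Type w) [LinearOrder 𝕍] [DecidableEq κ] :
    RawRoutingAlgebra.{u, max u w} 𝕍 :=
  bgpLiteWith 𝕍 κ (fun _ _ => true)

/-- Two path-weights are the same except possibly for their communities. -/
def PathWeight.SameUpToComm {𝕍 : Type u} {κ : Type w} [DecidableEq 𝕍] :
    PathWeight 𝕍 κ → PathWeight 𝕍 κ → Prop
  | .invalid, .invalid => True
  | .valid l _ p, .valid m _ q => l = m ∧ p = q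
  | _, _ => False

end DBF

/-! Selectivity, associativity and commutativity make `⊕` the minimum of a linear order whose last
element is `inf`. Convergence is proved with nested boxes of states, `hull T m`. A pseudocycle
starting at a positive time carries the asynchronous state from one box into the next
(`δ_mem_hull_succ`), so it suffices that some box is a single state, which is then the fixed point
(`alwaysConvergent_of_hull_singleton`).

For a fixed destination the routers settle one at a time, as in Dijkstra's algorithm
(`exists_settled_insert`). Among the unsettled routers, take one whose best route `c`, trivial or
through a settled neighbour, is the most preferred. Extending a route never improves it, so a route
better than `c` can only have been handed round among unsettled routers. Each hand-over puts a new
router of `V` on its path, so such routes die out. This is why increase need not be strict.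

In `bgpLite` a lexicographic key turns `⊕` into a minimum, and the key determines the path-weight.
The left-biased `⊕` is commutative only up to communities, so the order argument does not apply to
it. But the routes compared in one round at `i` come through different neighbours and have different
paths, so the tie-break is never consulted (`F_tie_irrelevant`): both algebras have the same `F` and
the same boxes. -/

namespace DBF

universe u v w

/-! ### The linear order given by `⊕`. -/

section Order

variable {𝕍 : Type u} {A : RawRoutingAlgebra.{u, v} 𝕍}

theorem IsRoutingAlgebra.preferred_refl (hA : IsRoutingAlgebra A) (x : A.S) : Preferred A x x := by
  rcases hA.choice_sel x x with h | h <;> exact h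

theorem IsRoutingAlgebra.preferred_total (hA : IsRoutingAlgebra A) (x y : A.S) :
    Preferred A x y ∨ Preferred A y x := by
  rcases hA.choice_sel x y with h | h
  · exact Or.inl h
  · exact Or.inr ((hA.choice_comm y x).trans h)

theorem IsRoutingAlgebra.preferred_antisymm (hA : IsRoutingAlgebra A) {x y : A.S}
    (h : Preferred A x y) (h' : Preferred A y x) : x = y :=
  h.symm.trans ((hA.choice_comm x y).trans h')

theorem IsRoutingAlgebra.preferred_trans (hA : IsRoutingAlgebra A) {x y z : A.S}
    (h : Preferred A x y) (h' : Preferred A y z) : Preferred A x z := by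
  have h₁ := hA.choice_assoc x y z
  simp only [Preferred] at h h' ⊢
  simp only [h', h] at h₁
  exact h₁.symm

theorem IsRoutingAlgebra.preferred_inf (hA : IsRoutingAlgebra A) (x : A.S) :
    Preferred A x A.inf :=
  (hA.inf_identity x).1

theorem IsRoutingAlgebra.choice_preferred_left (hA : IsRoutingAlgebra A) (x y : A.S) :
    Preferred A (A.choice x y) x := by
  rcases hA.preferred_total x y with h | h
  · rw [show A.choice x y = x from h]
    exact hA.preferred_refl x
  · rw [hA.choice_comm x y, show A.choice y x = y from h]
    exact h

theorem IsRoutingAlgebra.choice_preferred_right (hA : IsRoutingAlgebra A) (x y : A.S) :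
    Preferred A (A.choice x y) y := by
  rw [hA.choice_comm x y]
  exact hA.choice_preferred_left y x

theorem IsRoutingAlgebra.exists_preferred (hA : IsRoutingAlgebra A) {ι : Type*} (g : ι → A.S)
    {s : Finset ι} (hs : s.Nonempty) : ∃ i ∈ s, ∀ i' ∈ s, Preferred A (g i) (g i') := by
  induction hs using Finset.Nonempty.cons_induction with
  | singleton a => exact ⟨a, by simp, by simp [hA.preferred_refl]⟩
  | cons a s ha hs ih =>
    obtain ⟨b, hb, hmin⟩ := ih
    rcases hA.preferred_total (g a) (g b) with h | h
    · refine ⟨a, by simp, fun i' hi' => ?_⟩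
      rcases Finset.mem_cons.1 hi' with rfl | hi'
      · exact hA.preferred_refl _
      · exact hA.preferred_trans h (hmin i' hi')
    · refine ⟨b, by simp [hb], fun i' hi' => ?_⟩
      rcases Finset.mem_cons.1 hi' with rfl | hi'
      · exact h
      · exact hmin i' hi'

/-- Only selectivity is assumed, so that the lemma also serves choice operators that are not
commutative. -/
theorem foldr_choice_mem (hsel : ∀ x y, A.choice x y = x ∨ A.choice x y = y) {ι : Type*}
    (g : ι → A.S) (l : List ι) :
    l.foldr (fun k x => A.choice (g k) x) A.inf = A.inf ∨
      ∃ k ∈ l, l.foldr (fun k x => A.choice (g k) x) A.inf = g k := by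
  induction l with
  | nil => exact Or.inl rfl
  | cons a l ih =>
    rw [List.foldr_cons]
    rcases hsel (g a) (l.foldr (fun k x => A.choice (g k) x) A.inf) with h | h
    · exact Or.inr ⟨a, by simp, h⟩
    · rw [h]
      rcases ih with ih | ⟨k, hk, ih⟩
      · exact Or.inl ih
      · exact Or.inr ⟨k, by simp [hk], ih⟩

theorem Schedule.η_eq_of_mem_Icc {V : Finset 𝕍} {ψ : Schedule V} {a b t : ℕ}
    (h : ψ.η a = ψ.η b) (hat : a ≤ t) (htb : t ≤ b) : ψ.η t = ψ.η a :=
  le_antisymm (h ▸ ψ.monotone t b htb) (ψ.monotone a t hat)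

end Order

/-! ### One synchronous round, and the nested boxes. -/

section Round

variable {𝕍 : Type u} [LinearOrder 𝕍] {A : RawRoutingAlgebra.{u, v} 𝕍} {V : Finset 𝕍}

theorem F_cases (hA : IsRoutingAlgebra A) (T : Topology A V) (X : State A V) (i j : V) :
    F T X i j = identity A V i j ∨ F T X i j = A.inf ∨
      ∃ k, F T X i j = (T i k : A.S → A.S) (X k j) := by
  rcases hA.choice_sel (bigChoice A V (fun k => (T i k : A.S → A.S) (X k j)))
    (identity A V i j) with h | h
  · right
    unfold F
    rw [h]
    rcases foldr_choice_mem hA.choice_sel (fun k => (T i k : A.S → A.S) (X k j))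
      ((Finset.univ : Finset V).sort (· ≤ ·)) with h | ⟨k, -, h⟩
    · exact Or.inl h
    · exact Or.inr ⟨k, h⟩
  · exact Or.inl h

theorem F_preferred_identity (hA : IsRoutingAlgebra A) (T : Topology A V) (X : State A V)
    (i j : V) : Preferred A (F T X i j) (identity A V i j) :=
  hA.choice_preferred_right _ _

theorem bigChoice_preferred (hA : IsRoutingAlgebra A) (g : V → A.S) (k : V) :
    Preferred A (bigChoice A V g) (g k) := by
  have key : ∀ l : List V, k ∈ l →
      Preferred A (l.foldr (fun k x => A.choice (g k) x) A.inf) (g k) := by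
    intro l
    induction l with
    | nil => simp
    | cons a l ih =>
      intro hk
      rw [List.foldr_cons]
      rcases List.mem_cons.1 hk with rfl | hk
      · exact hA.choice_preferred_left _ _
      · exact hA.preferred_trans (hA.choice_preferred_right _ _) (ih hk)
  exact key _ (by simp)

theorem F_preferred_extension (hA : IsRoutingAlgebra A) (T : Topology A V) (X : State A V)
    (i j k : V) : Preferred A (F T X i j) ((T i k : A.S → A.S) (X k j)) :=
  hA.preferred_trans (hA.choice_preferred_left _ _)
    (bigChoice_preferred hA (fun k => (T i k : A.S → A.S) (X k j)) k)

/-- The smallest boxes (products of sets of entries) that contain the states reached by `m`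
rounds from any state, in which every router may use different previous states. -/
def hull (T : Topology A V) : ℕ → V → V → Set A.S
  | 0 => fun _ _ => Set.univ
  | m + 1 => fun i j => {x | ∃ X : State A V, (∀ k l, X k l ∈ hull T m k l) ∧ x = F T X i j}

theorem F_mem_hull {T : Topology A V} {m : ℕ} {X : State A V} (h : ∀ k l, X k l ∈ hull T m k l)
    (i j : V) : F T X i j ∈ hull T (m + 1) i j :=
  ⟨X, h, rfl⟩

theorem exists_mem_hull (T : Topology A V) (m : ℕ) :
    ∃ X : State A V, ∀ i j, X i j ∈ hull T m i j := by
  induction m with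
  | zero => exact ⟨identity A V, fun _ _ => trivial⟩
  | succ m ih =>
    obtain ⟨X, hX⟩ := ih
    exact ⟨F T X, fun i j => F_mem_hull hX i j⟩

theorem hull_succ_subset (T : Topology A V) (m : ℕ) (i j : V) :
    hull T (m + 1) i j ⊆ hull T m i j := by
  induction m generalizing i j with
  | zero => exact fun _ _ => trivial
  | succ m ih =>
    rintro x ⟨X, hX, rfl⟩
    exact ⟨X, fun k l => ih k l (hX k l), rfl⟩

theorem hull_antitone (T : Topology A V) {m n : ℕ} (h : m ≤ n) (i j : V) :
    hull T n i j ⊆ hull T m i j := by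
  induction h with
  | refl => exact subset_rfl
  | step _ ih => exact (hull_succ_subset T _ i j).trans ih

end Round

/-! ### The boxes shrink to a point in an increasing path algebra. -/

section Settling

variable {𝕍 : Type u} [LinearOrder 𝕍] {A : RawRoutingAlgebra.{u, v} 𝕍} {V : Finset 𝕍}

open Classical in
/-- The number of routers of `V` on a path. -/
noncomputable def visits (V : Finset 𝕍) (p : SimplePath 𝕍) : ℕ :=
  (V.filter (fun v => v ∈ vertices p.edges)).card

theorem visits_le (V : Finset 𝕍) (p : SimplePath 𝕍) : visits V p ≤ V.card :=
  Finset.card_filter_le _ _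

/-- Arbitrary initial states may hold paths through routers outside `V`. Counting only routers of
`V` gives the bound `V.card`, and an extension still counts because its new router lies in `V`. -/
theorem visits_cons (V : Finset 𝕍) {i j : 𝕍} (hi : i ∈ V) (p : SimplePath 𝕍)
    (h : CanExtend i j p.edges) : visits V p + 1 ≤ visits V (p.cons i j h) := by
  classical
  unfold visits
  rw [← Finset.card_insert_of_notMem (a := i) (by simp [h.2.2])]
  refine Finset.card_le_card fun v hv => ?_
  rcases Finset.mem_insert.1 hv with rfl | hv
  · simp [hi, SimplePath.cons, vertices]
  · obtain ⟨hvV, hv⟩ := Finset.mem_filter.1 hv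
    refine Finset.mem_filter.2 ⟨hvV, ?_⟩
    obtain ⟨e, he, h'⟩ := mem_vertices_of_mem_edge hv
    exact mem_vertices (p.cons i j h).contiguous ⟨e, List.mem_cons_of_mem _ he, h'⟩

/-- An entry that is less preferred than every new offer to the unsettled routers can only be the
extension of a path through many of them. -/
theorem preferred_or_visits (hA : IsRoutingAlgebra A) {path : A.S → Paths 𝕍}
    (hP : IsPathAlgebra A path) (hI : IsIncreasing A) (T : Topology A V) {j : V} {D : Finset V}
    {K : ℕ} {w : V → A.S} (hw : ∀ i ∈ D, hull T K i j ⊆ {w i}) {c : A.S}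
    (hid : ∀ i ∉ D, Preferred A c (identity A V i j))
    (hext : ∀ i ∉ D, ∀ k ∈ D, Preferred A c ((T i k : A.S → A.S) (w k))) (r : ℕ) :
    ∀ i ∉ D, ∀ x ∈ hull T (K + r) i j,
      Preferred A c x ∨ ∃ p : SimplePath 𝕍, path x = p ∧ r ≤ visits V p := by
  induction r with
  | zero =>
    intro i _ x _
    by_cases hx : x = A.inf
    · exact Or.inl (hx ▸ hA.preferred_inf c)
    · obtain ⟨p, hp⟩ := WithBot.ne_bot_iff_exists.1 (fun h => hx ((hP.path_inf x).2 h))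
      exact Or.inr ⟨p, hp.symm, Nat.zero_le _⟩
  | succ r ih =>
    rintro i hi x ⟨X, hX, rfl⟩
    rcases F_cases hA T X i j with h | h | ⟨k, h⟩
    · exact Or.inl (h ▸ hid i hi)
    · exact Or.inl (h ▸ hA.preferred_inf c)
    · rw [h]
      by_cases hk : k ∈ D
      · have : X k j = w k := hw k hk (hull_antitone T (Nat.le_add_right K r) k j (hX k j))
        exact Or.inl (this ▸ hext i hi k hk)
      -- From an unsettled neighbour, a route no better than `c` stays so by increase, and a path
      -- through `r` routers is either rejected or gains the new router `i`.
      · rcases ih k hk _ (hX k j) with h' | ⟨p, hp, hr⟩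
        · exact Or.inl (hA.preferred_trans h' (hI i k _ (T i k).2 _))
        · by_cases hinf : (T i k : A.S → A.S) (X k j) = A.inf
          · exact Or.inl (hinf ▸ hA.preferred_inf c)
          · by_cases he : CanExtend (i : 𝕍) k p.edges
            · exact Or.inr ⟨_, hP.path_accept i k _ (T i k).2 _ p hp he hinf,
                (Nat.succ_le_succ hr).trans (visits_cons V i.2 p he)⟩
            · exact absurd ((hP.path_inf _).2 (hP.path_reject i k _ (T i k).2 _ p hp he)) hinf

/-- If the routers of `D` have settled on their routes to `j`, then another router will. -/
theorem exists_settled_insert (hA : IsRoutingAlgebra A) {path : A.S → Paths 𝕍}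
    (hP : IsPathAlgebra A path) (hI : IsIncreasing A) (T : Topology A V) {j : V} {D : Finset V}
    {K : ℕ} {w : V → A.S} (hw : ∀ i ∈ D, hull T K i j ⊆ {w i}) (hD : D ≠ Finset.univ) :
    ∃ i ∉ D, ∃ c, hull T (K + (V.card + 2)) i j ⊆ {c} := by
  classical
  -- Unsettled routers hold `inf` in `Y`, so `F T Y i j` is the best route of `i` that is trivial or
  -- goes through `D`.
  let Y : State A V := fun k _ => if k ∈ D then w k else A.inf
  have hne : Dᶜ.Nonempty := by
    rwa [Finset.nonempty_iff_ne_empty, Ne, Finset.compl_eq_empty_iff]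
  obtain ⟨i, hi, hmin⟩ := hA.exists_preferred (fun i => F T Y i j) hne
  have hi : i ∉ D := Finset.mem_compl.1 hi
  have hmin : ∀ i' ∉ D, Preferred A (F T Y i j) (F T Y i' j) :=
    fun i' h => hmin i' (Finset.mem_compl.2 h)
  have hY : ∀ k ∈ D, Y k j = w k := fun k hk => if_pos hk
  have hbound := preferred_or_visits hA hP hI T hw (c := F T Y i j)
    (fun i' h => hA.preferred_trans (hmin i' h) (F_preferred_identity hA T Y i' j))
    (fun i' h k hk => hA.preferred_trans (hmin i' h)
      (hY k hk ▸ F_preferred_extension hA T Y i' j k))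
  refine ⟨i, hi, F T Y i j, fun x hx => ?_⟩
  have hcx : Preferred A (F T Y i j) x := by
    -- Here `r` is `V.card + 2`, more routers than `V` has.
    rcases hbound _ i hi x hx with h | ⟨p, -, hr⟩
    · exact h
    · have := visits_le V p
      omega
  obtain ⟨X, hX, rfl⟩ : ∃ X : State A V, (∀ k l, X k l ∈ hull T (K + (V.card + 1)) k l) ∧
    x = F T X i j := hx
  -- Conversely, whatever produced `c` is still on offer in `X`: the identity entry, or the route of
  -- a settled neighbour, where `X` and `Y` agree.
  refine hA.preferred_antisymm ?_ hcx
  rcases F_cases hA T Y i j with h | h | ⟨k, h⟩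
  · rw [h]
    exact F_preferred_identity hA T X i j
  · rw [h]
    exact hA.preferred_inf _
  · by_cases hk : k ∈ D
    · have : X k j = Y k j :=
        (hw k hk (hull_antitone T (Nat.le_add_right K _) k j (hX k j))).trans (hY k hk).symm
      rw [h, ← this]
      exact F_preferred_extension hA T X i j k
    · have : (T i k : A.S → A.S) (Y k j) = A.inf := by
        rw [show Y k j = A.inf from if_neg hk]
        exact hA.inf_fixed i k _ (T i k).2
      rw [h, this]
      exact hA.preferred_inf _

theorem exists_hull_singleton_of_destination (hA : IsRoutingAlgebra A) {path : A.S → Paths 𝕍}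
    (hP : IsPathAlgebra A path) (hI : IsIncreasing A) (T : Topology A V) (j : V) :
    ∃ K, ∀ i, ∃ c, hull T K i j ⊆ {c} := by
  classical
  have key : ∀ a ≤ Fintype.card V, ∃ (D : Finset V) (K : ℕ), D.card = a ∧
      ∀ i ∈ D, ∃ c, hull T K i j ⊆ {c} := by
    intro a
    induction a with
    | zero => exact fun _ => ⟨∅, 0, by simp⟩
    | succ a ih =>
      intro ha
      obtain ⟨D, K, hcard, hD⟩ := ih (by omega)
      have : Nonempty A.S := ⟨A.inf⟩
      choose! w hw using hD
      obtain ⟨i, hi, c, hc⟩ := exists_settled_insert hA hP hI T hw (by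
        rintro rfl
        rw [Finset.card_univ] at hcard
        omega)
      refine ⟨insert i D, K + (V.card + 2), by rw [Finset.card_insert_of_notMem hi, hcard], ?_⟩
      intro k hk
      rcases Finset.mem_insert.1 hk with rfl | hk
      · exact ⟨c, hc⟩
      · exact ⟨w k, (hull_antitone T (Nat.le_add_right _ _) k j).trans (hw k hk)⟩
  obtain ⟨D, K, hcard, hD⟩ := key _ le_rfl
  rw [Finset.card_eq_iff_eq_univ] at hcard
  exact ⟨K, fun i => hD i (hcard ▸ Finset.mem_univ i)⟩

theorem exists_hull_singleton (hA : IsRoutingAlgebra A) {path : A.S → Paths 𝕍}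
    (hP : IsPathAlgebra A path) (hI : IsIncreasing A) (T : Topology A V) :
    ∃ (K : ℕ) (Y : State A V), ∀ i j, hull T K i j ⊆ {Y i j} := by
  choose K hK using exists_hull_singleton_of_destination hA hP hI T
  choose c hc using hK
  -- Destinations do not interact, so the latest of their settling rounds serves for all.
  exact ⟨Finset.univ.sup K, fun i j => c j i, fun i j =>
    (hull_antitone T (Finset.le_sup (Finset.mem_univ j)) i j).trans (hc j i)⟩

end Settling

/-! ### From boxes to the asynchronous protocol. -/

section Asynchronous

variable {𝕍 : Type u} [LinearOrder 𝕍] {A : RawRoutingAlgebra.{u, v} 𝕍} {V : Finset 𝕍}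

/-- The two laws `hinf` and `hf` hold with genuine equality in the left-biased algebra too, so this
section up to `alwaysConvergent_of_hull_singleton` applies to it. -/
theorem F_participating_of_notMem (hinf : ∀ x, A.choice A.inf x = x)
    (hf : ∀ i j x, (A.fInf i j : A.S → A.S) x = A.inf) (N : Network A V) (e : ℕ) {p : Set V}
    {i : V} (hi : i ∉ p) (X : State A V) (j : V) :
    F (participating N e p) X i j = identity A V i j := by
  have h : ∀ l : List V, l.foldr (fun k x =>
      A.choice ((participating N e p i k : A.S → A.S) (X k j)) x) A.inf = A.inf := by
    intro l
    induction l with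
    | nil => rfl
    | cons a l ih =>
      rw [List.foldr_cons, ih]
      simp [participating, hi, hf, hinf]
  unfold F bigChoice
  rw [h, hinf]

/-- Routers that do not participate are frozen at their identity row; this keeps the whole state
inside the boxes. -/
theorem identity_mem_hull (hinf : ∀ x, A.choice A.inf x = x)
    (hf : ∀ i j x, (A.fInf i j : A.S → A.S) x = A.inf) (N : Network A V) (e : ℕ) {p : Set V}
    {i : V} (hi : i ∉ p) (m : ℕ) (j : V) :
    identity A V i j ∈ hull (participating N e p) m i j := by
  cases m with
  | zero => trivial
  | succ m =>
    obtain ⟨X, hX⟩ := exists_mem_hull (participating N e p) m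
    exact ⟨X, hX, (F_participating_of_notMem hinf hf N e hi X j).symm⟩

theorem δ_of_notMem (N : Network A V) (X : State A V) (ψ : Schedule V) {t : ℕ} {i : V}
    (hi : i ∉ ψ.ρ t) (j : V) : δ N X ψ t i j = identity A V i j := by
  cases t <;> · rw [δ]; simp [hi]

theorem δ_succ_of_mem (N : Network A V) (X : State A V) (ψ : Schedule V) {t : ℕ} {i : V}
    (hη : ψ.η (t + 1) = ψ.η t) (hi : i ∈ ψ.ρ t) (j : V) :
    (i ∉ ψ.α (t + 1) ∧ δ N X ψ (t + 1) i j = δ N X ψ t i j) ∨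
    (δ N X ψ (t + 1) i j = F (participating N (ψ.η t) (ψ.ρ t))
        (fun k l => δ N X ψ (ψ.β (t + 1) i k) k l) i j) := by
  have hρ : ψ.ρ (t + 1) = ψ.ρ t := by simp [Schedule.ρ, hη]
  by_cases hα : i ∈ ψ.α (t + 1)
  · right
    rw [δ]
    simp [hρ, hη, hi, hα]
  · left
    refine ⟨hα, ?_⟩
    rw [δ]
    simp [hρ, hi, hα]

/-- A pseudocycle makes the asynchronous state progress by one round. -/
theorem δ_mem_hull_succ (hinf : ∀ x, A.choice A.inf x = x)
    (hf : ∀ i j x, (A.fInf i j : A.S → A.S) x = A.inf) (N : Network A V) (X : State A V)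
    (ψ : Schedule V) {s e t₃ m : ℕ} (hs : 0 < s) (hst : s ≤ e) (hse : ψ.Pseudocycle s e)
    (het : e ≤ t₃)
    (hη : ψ.η s = ψ.η t₃)
    (hm : ∀ t, s ≤ t → t ≤ t₃ → ∀ i j,
      δ N X ψ t i j ∈ hull (participating N (ψ.η s) (ψ.ρ s)) m i j) (i j : V) :
    δ N X ψ t₃ i j ∈ hull (participating N (ψ.η s) (ψ.ρ s)) (m + 1) i j := by
  have hρ : ∀ t, s ≤ t → t ≤ t₃ → ψ.ρ t = ψ.ρ s := fun t h h' => by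
    simp [Schedule.ρ, Schedule.η_eq_of_mem_Icc hη h h']
  by_cases hi : i ∈ ψ.ρ s
  · obtain ⟨t, hst', hte, ⟨-, hβ⟩, -, t', htt', ht'e, hα⟩ := hse.2 i hi
    -- Data used at time `t` are no older than `s` and, as `t > 0`, were produced before `t`. Hence
    -- `i` participates already at `t' - 1`, and its activation at `t'` applies `F` instead of
    -- restoring the initial state.
    have hlt : s < t := by
      obtain ⟨t, rfl⟩ : ∃ t₀, t = t₀ + 1 := ⟨t - 1, by omega⟩
      have := hβ i _ le_rfl
      have := ψ.causal t i i
      omega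
    -- Any recomputation at `b + 1 ≥ t` reads data from between `s` and `b`, all of them in box `m`.
    have hcompute : ∀ b, t ≤ b + 1 → b + 1 ≤ t₃ → F (participating N (ψ.η b) (ψ.ρ b))
        (fun k l => δ N X ψ (ψ.β (b + 1) i k) k l) i j ∈
        hull (participating N (ψ.η s) (ψ.ρ s)) (m + 1) i j := by
      intro b hb hb'
      rw [hρ b (by omega) (by omega), Schedule.η_eq_of_mem_Icc hη (by omega) (by omega : b ≤ t₃)]
      refine F_mem_hull (fun k l => hm _ (hβ k _ hb) ?_ k l) i j
      have := ψ.causal b i k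
      omega
    -- From its activation on, the entry of `i` is either recomputed from box `m` or kept.
    have key : ∀ b, t' ≤ b → b ≤ t₃ →
        δ N X ψ b i j ∈ hull (participating N (ψ.η s) (ψ.ρ s)) (m + 1) i j := by
      intro b hb
      have hstep : ∀ b, s ≤ b → b + 1 ≤ t₃ → ψ.η (b + 1) = ψ.η b ∧ i ∈ ψ.ρ b := fun b h h' =>
        ⟨(Schedule.η_eq_of_mem_Icc hη (by omega) h').trans
          (Schedule.η_eq_of_mem_Icc hη h (by omega)).symm, hρ b h (by omega) ▸ hi⟩
      induction b, hb using Nat.le_induction with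
      | base =>
        intro h
        obtain ⟨b, rfl⟩ : ∃ b, t' = b + 1 := ⟨t' - 1, by omega⟩
        obtain ⟨h₁, h₂⟩ := hstep b (by omega) h
        rcases δ_succ_of_mem N X ψ h₁ h₂ j with h' | h'
        · exact absurd hα h'.1
        · exact h' ▸ hcompute b htt' h
      | succ b hb ih =>
        intro h
        obtain ⟨h₁, h₂⟩ := hstep b (by omega) h
        rcases δ_succ_of_mem N X ψ h₁ h₂ j with h' | h'
        · exact h'.2 ▸ ih (by omega)
        · exact h' ▸ hcompute b (by omega) h
    exact key t₃ (by omega) le_rfl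
  · rw [δ_of_notMem N X ψ (by rwa [hρ t₃ (hst.trans het) le_rfl])]
    exact identity_mem_hull hinf hf N _ hi _ j

/-- Convergence, if the boxes `hull T m` shrink to a single state for all topologies `T`. -/
theorem alwaysConvergent_of_hull_singleton (hinf : ∀ x, A.choice A.inf x = x)
    (hf : ∀ i j x, (A.fInf i j : A.S → A.S) x = A.inf)
    (hull_singleton : ∀ (V : Finset 𝕍) (T : Topology A V),
      ∃ (K : ℕ) (Y : State A V), ∀ i j, hull T K i j ⊆ {Y i j}) :
    AlwaysConvergent A := by
  intro V N
  choose K Y hY using fun c : ℕ × Set V => hull_singleton V (participating N c.1 c.2)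
  -- The first pseudocycle may start at time `0`, where `β` is unconstrained. It is spent on making
  -- the later ones start at positive times.
  refine ⟨Y, fun c => K c + 1, fun c _ => ?_, ?_⟩
  · have hmem : ∀ i j, Y c i j ∈ hull (participating N c.1 c.2) (K c) i j := by
      obtain ⟨X, hX⟩ := exists_mem_hull (participating N c.1 c.2) (K c)
      intro i j
      rw [← show X i j = Y c i j from hY c i j (hX i j)]
      exact hX i j
    funext i j
    -- `F` sends box `K c` into box `K c + 1`, which lies in box `K c`, hence in `{Y c}`.
    exact hY c i j (hull_succ_subset _ _ i j (F_mem_hull hmem i j))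
  · rintro X ψ t₁ t₂ - h₁₂ hη ⟨s, e, hse, hes⟩ t₃ h₂₃ hη'
    have key : ∀ m < K (ψ.η t₁, ψ.ρ t₁) + 1, ∀ t, e m ≤ t → t ≤ t₃ → ∀ i j,
        δ N X ψ t i j ∈ hull (participating N (ψ.η t₁) (ψ.ρ t₁)) m i j := by
      intro m
      induction m with
      | zero => exact fun _ _ _ _ _ _ => trivial
      | succ m ih =>
        intro hm t het ht i j
        obtain ⟨h1, h2, h3, h4⟩ := hse (m + 1) hm
        obtain ⟨-, h5, -⟩ := hse m ((Nat.lt_succ_self m).trans hm)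
        have h6 := hes m hm
        have hs : ψ.η (s (m + 1)) = ψ.η t₁ :=
          Schedule.η_eq_of_mem_Icc (hη.trans hη') h1 (by omega)
        have ht' : ψ.η t = ψ.η t₁ := Schedule.η_eq_of_mem_Icc (hη.trans hη') (by omega) ht
        have hρ : ψ.ρ (s (m + 1)) = ψ.ρ t₁ := by simp [Schedule.ρ, hs]
        have := δ_mem_hull_succ hinf hf N X ψ (by omega) h2.le h4 het (hs.trans ht'.symm) (m := m)
          (fun b hb hb' => by
            rw [hs, hρ]
            exact ih (by omega) b (by omega) (by omega)) i j
        rwa [hs, hρ] at this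
    funext i j
    exact hY (ψ.η t₁, ψ.ρ t₁) i j
      (key _ (Nat.lt_succ_self _) t₃ (by have := hse _ (Nat.lt_succ_self _); omega) le_rfl i j)

/-- The protocol of an increasing path algebra is always convergent. -/
theorem IsIncreasing.alwaysConvergent (hI : IsIncreasing A) (hA : IsRoutingAlgebra A)
    {path : A.S → Paths 𝕍} (hP : IsPathAlgebra A path) : AlwaysConvergent A :=
  alwaysConvergent_of_hull_singleton (fun x => (hA.inf_identity x).2) hA.fInf_inf
    (fun _ T => exists_hull_singleton hA hP hI T)

end Asynchronous

/-! ### Choice as minimisation of a key. -/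

section ArgMin

variable {S L : Type*} [LinearOrder L]

/-- The left-biased choice of the argument with the smaller key. -/
def argMin (key : S → L) (x y : S) : S :=
  if key x ≤ key y then x else y

theorem key_argMin (key : S → L) (x y : S) : key (argMin key x y) = min (key x) (key y) := by
  unfold argMin
  split_ifs with h
  · rw [min_eq_left h]
  · rw [min_eq_right (le_of_not_ge h)]

end ArgMin

/-! ### Paths and policies: path algebra and increase, for every tie-break. -/

section BgpLite

variable {𝕍 : Type u} {κ : Type w}

theorem StoredPath.length_inflate [DecidableEq 𝕍] (p : StoredPath 𝕍) (n : ℕ) :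
    p.edges.length ≤ (p.inflate n).edges.length := by
  unfold StoredPath.inflate DBF.inflate
  dsimp only
  split
  · simp_all
  · simp_all

theorem StoredPath.deflate_inflate [DecidableEq 𝕍] (p : StoredPath 𝕍) (n : ℕ) :
    (p.inflate n).deflate = p.deflate :=
  SimplePath.ext (DBF.deflate_inflate p.edges n)

theorem deflate_eq_self [DecidableEq 𝕍] : ∀ {p : List (𝕍 × 𝕍)}, Contiguous p →
    (vertices p).Nodup → deflate p = p
  | [], _, _ => rfl
  | (i, j) :: q, hc, h => by
    obtain ⟨ha, hq⟩ := contiguous_cons.1 hc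
    have hij : i ≠ j := by
      rintro rfl
      simp [vertices] at h
    have hd : deflate ((i, j) :: q) = (i, j) :: deflate q := by simp [deflate, hij]
    rw [hd]
    by_cases hn : q = []
    · subst hn
      rfl
    · rw [vertices_cons ha hn, List.nodup_cons] at h
      rw [deflate_eq_self hq h.2]

/-- The converse fails: `[(i, i)]` deflates to `[]`, which `(i, k)` with `k ≠ i` can extend. The
policy function then rejects, which a path algebra always permits. -/
theorem canExtend_deflate [DecidableEq 𝕍] {i j : 𝕍} {p : List (𝕍 × 𝕍)} (hp : Contiguous p)
    (h : CanExtend i j p) : CanExtend i j (deflate p) := by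
  refine ⟨deflate_aligned hp h.1, h.2.1, fun hi => h.2.2 ?_⟩
  obtain ⟨e, he, h'⟩ := mem_vertices_of_mem_edge hi
  exact mem_vertices hp ⟨e, (List.mem_filter.1 he).1, h'⟩

theorem StoredPath.deflate_cons [DecidableEq 𝕍] {i j : 𝕍} {p : StoredPath 𝕍}
    (h : CanExtend i j p.edges) :
    (p.cons i j h).deflate = p.deflate.cons i j (canExtend_deflate p.contiguous h) := by
  ext1
  simp [StoredPath.deflate, StoredPath.cons, SimplePath.cons, DBF.deflate, h.2.1]

theorem Policy.apply_invalid [DecidableEq 𝕍] [DecidableEq κ] (pol : Policy 𝕍 κ) :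
    pol.apply .invalid = .invalid := by
  cases pol <;> simp [Policy.apply]

/-- These invariants are stable under composition. They say that no policy makes a route more
attractive by preference or length, or alters its deflated path. -/
theorem Policy.apply_valid [DecidableEq 𝕍] [DecidableEq κ] (pol : Policy 𝕍 κ) (l : LocalPref)
    (cs : Finset κ) (p : StoredPath 𝕍) :
    pol.apply (.valid l cs p) = .invalid ∨ ∃ m ds q, pol.apply (.valid l cs p) = .valid m ds q ∧
      m ≤ l ∧ p.edges.length ≤ q.edges.length ∧ q.deflate = p.deflate := by
  induction pol generalizing l cs p with
  | reject => exact Or.inl (by simp [Policy.apply])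
  | decrPrefBy n =>
    exact Or.inr ⟨l.decrBy n, cs, p, by simp [Policy.apply], Nat.sub_le l.val n, le_rfl, rfl⟩
  | addComm c => exact Or.inr ⟨l, insert c cs, p, by simp [Policy.apply], le_rfl, le_rfl, rfl⟩
  | delComm c => exact Or.inr ⟨l, cs.erase c, p, by simp [Policy.apply], le_rfl, le_rfl, rfl⟩
  | inflate n =>
    exact Or.inr ⟨l, cs, p.inflate n, by simp [Policy.apply], le_rfl, p.length_inflate n,
      p.deflate_inflate n⟩
  | seq a b iha ihb =>
    have hab : (Policy.seq a b).apply (.valid l cs p) = b.apply (a.apply (.valid l cs p)) := by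
      simp [Policy.apply]
    rw [hab]
    rcases iha l cs p with h | ⟨m, ds, q, h, h₁, h₂, h₃⟩
    · exact Or.inl (by rw [h, Policy.apply_invalid])
    · rw [h]
      rcases ihb m ds q with h' | ⟨m', ds', q', h', h₁', h₂', h₃'⟩
      · exact Or.inl h'
      · exact Or.inr ⟨m', ds', q', h', h₁'.trans h₁, h₂.trans h₂', h₃'.trans h₃⟩
  | cond c a ih =>
    by_cases hc : c.eval (.valid l cs p) = true
    · simpa [Policy.apply, hc] using ih l cs p
    · exact Or.inr ⟨l, cs, p, by simp [Policy.apply, hc], le_rfl, le_rfl, rfl⟩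

theorem policyFunction_invalid [DecidableEq 𝕍] [DecidableEq κ] (i j : 𝕍) (pol : Policy 𝕍 κ) :
    policyFunction i j pol .invalid = .invalid := by
  simp [policyFunction]

theorem policyFunction_of_not_canExtend [DecidableEq 𝕍] [DecidableEq κ] {i j : 𝕍}
    (pol : Policy 𝕍 κ) (l : LocalPref) (cs : Finset κ) {p : StoredPath 𝕍}
    (h : ¬ CanExtend i j p.edges) : policyFunction i j pol (.valid l cs p) = .invalid := by
  simp [policyFunction, h]

theorem policyFunction_valid [DecidableEq 𝕍] [DecidableEq κ] {i j : 𝕍} (pol : Policy 𝕍 κ)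
    {l : LocalPref} {cs : Finset κ} {p : StoredPath 𝕍}
    (hne : policyFunction i j pol (.valid l cs p) ≠ .invalid) :
    ∃ (h : CanExtend i j p.edges) (m : LocalPref) (ds : Finset κ) (q : StoredPath 𝕍),
      policyFunction i j pol (.valid l cs p) = .valid m ds q ∧ m ≤ l ∧
      p.edges.length < q.edges.length ∧
      q.deflate = p.deflate.cons i j (canExtend_deflate p.contiguous h) := by
  by_cases h : CanExtend i j p.edges
  · have hf : policyFunction i j pol (.valid l cs p) = pol.apply (.valid l cs (p.cons i j h)) := by
      simp [policyFunction, h]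
    rw [hf] at hne ⊢
    obtain ⟨m, ds, q, h₀, h₁, h₂, h₃⟩ := (pol.apply_valid l cs (p.cons i j h)).resolve_left hne
    exact ⟨h, m, ds, q, h₀, h₁, h₂, h₃.trans (StoredPath.deflate_cons h)⟩
  · exact absurd (policyFunction_of_not_canExtend pol l cs h) hne

theorem PathWeight.path_eq_bot_iff [DecidableEq 𝕍] (x : PathWeight 𝕍 κ) :
    x.path = ⊥ ↔ x = .invalid := by
  cases x <;> simp [PathWeight.path]

theorem isPathAlgebra_bgpLiteWith [LinearOrder 𝕍] [DecidableEq κ]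
    (tie : Finset κ → Finset κ → Bool) :
    IsPathAlgebra (bgpLiteWith 𝕍 κ tie) PathWeight.path where
  path_inf x := (PathWeight.path_eq_bot_iff x).symm
  path_zero := by
    rintro x rfl
    rfl
  path_absent := by
    rintro i j _ ⟨pol, rfl⟩ x hx
    rw [(PathWeight.path_eq_bot_iff x).1 hx, policyFunction_invalid]
    rfl
  path_reject := by
    rintro i j _ ⟨pol, rfl⟩ (_ | ⟨l, cs, q⟩) p hp h
    · exact absurd hp.symm (WithBot.coe_ne_bot)
    · obtain rfl : q.deflate = p := WithBot.coe_injective hp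
      rw [policyFunction_of_not_canExtend pol l cs
        (fun h' => h (canExtend_deflate q.contiguous h'))]
      rfl
  path_accept := by
    rintro i j _ ⟨pol, rfl⟩ (_ | ⟨l, cs, q⟩) p hp h hne
    · exact absurd hp.symm (WithBot.coe_ne_bot)
    · obtain rfl : q.deflate = p := WithBot.coe_injective hp
      obtain ⟨_, m, ds, q', h₀, -, -, h₃⟩ := policyFunction_valid pol hne
      rw [h₀]
      exact congrArg WithBot.some h₃

theorem isIncreasing_bgpLiteWith [LinearOrder 𝕍] [DecidableEq κ]
    (tie : Finset κ → Finset κ → Bool) : IsIncreasing (bgpLiteWith 𝕍 κ tie) := by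
  rintro i j _ ⟨pol, rfl⟩ x
  change PathWeight.choice tie x (policyFunction i j pol x) = x
  by_cases hne : policyFunction i j pol x = .invalid
  · rw [hne]
    cases x <;> rfl
  · rcases x with _ | ⟨l, cs, p⟩
    · exact absurd (policyFunction_invalid i j pol) hne
    · obtain ⟨_, m, ds, q, h₀, h₁, h₂, -⟩ := policyFunction_valid pol hne
      rw [h₀]
      -- At equal preferences the stored path has become strictly longer, so neither paths nor
      -- communities are compared.
      simp [PathWeight.choice, h₁.not_gt, h₂]

end BgpLite

/-! ### Keys for the choice operators, and the routing algebra axioms. -/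

section Ranking

variable {𝕍 : Type u} {κ : Type w} [LinearOrder 𝕍]

/-- The rank of a valid path-weight, disregarding its communities: smaller ranks are preferred. -/
def rank (l : LocalPref) (p : StoredPath 𝕍) : LocalPrefᵒᵈ ×ₗ ℕ ×ₗ List (𝕍 ×ₗ 𝕍) :=
  toLex (OrderDual.toDual l, toLex (p.edges.length, p.edges.map toLex))

theorem rank_inj {l m : LocalPref} {p q : StoredPath 𝕍} :
    rank l p = rank m q ↔ l = m ∧ p = q := by
  refine ⟨fun h => ?_, by rintro ⟨rfl, rfl⟩; rfl⟩
  simp only [rank, toLex_inj, Prod.mk.injEq, OrderDual.toDual_inj] at h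
  exact ⟨h.1, StoredPath.ext (List.map_injective_iff.2 toLex.injective h.2.2)⟩

theorem PathWeight.choice_valid (tie : Finset κ → Finset κ → Bool) (l m : LocalPref)
    (cs ds : Finset κ) (p q : StoredPath 𝕍) :
    PathWeight.choice tie (.valid l cs p) (.valid m ds q) =
      if rank l p < rank m q then .valid l cs p
      else if rank m q < rank l p then .valid m ds q
      else if tie cs ds then .valid l cs p else .valid m ds q := by
  simp only [PathWeight.choice, rank, Prod.Lex.toLex_lt_toLex, OrderDual.toDual_lt_toDual,
    OrderDual.toDual_inj]
  rcases lt_trichotomy l m with h | rfl | h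
  · simp [h, h.not_gt, h.ne, h.ne']
  · rcases lt_trichotomy p.edges.length q.edges.length with h | h | h
    · simp [h]
    · simp [h]
    · simp [h, h.not_gt, h.ne, h.ne']
  · simp [h]

theorem rank_highest_nil_le (l : LocalPref) (p : StoredPath 𝕍) :
    rank LocalPref.highest StoredPath.nil ≤ rank l p := by
  refine le_of_not_gt fun h => ?_
  simp only [rank, Prod.Lex.toLex_lt_toLex, OrderDual.toDual_lt_toDual, OrderDual.toDual_inj,
    StoredPath.nil, List.length_nil, List.map_nil] at h
  rcases h with h | ⟨-, h | ⟨-, h⟩⟩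
  · have : LocalPref.highest.val < l.val := h
    have := l.isLt
    simp only [LocalPref.highest] at *
    omega
  · exact absurd h (Nat.not_lt_zero _)
  · exact List.not_lt_nil _ h

/-- The key that the left-biased choice minimises. -/
def PathWeight.key : PathWeight 𝕍 κ → WithTop (LocalPrefᵒᵈ ×ₗ ℕ ×ₗ List (𝕍 ×ₗ 𝕍))
  | .invalid => ⊤
  | .valid l _ p => (rank l p : LocalPrefᵒᵈ ×ₗ ℕ ×ₗ List (𝕍 ×ₗ 𝕍))

/-- The key that the choice of `bgpLite` minimises. -/
def PathWeight.fullKey :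
    PathWeight 𝕍 κ → WithTop ((LocalPrefᵒᵈ ×ₗ ℕ ×ₗ List (𝕍 ×ₗ 𝕍)) ×ₗ Colex (Finset κ))
  | .invalid => ⊤
  | .valid l cs p => (toLex (rank l p, toColex cs) :
      (LocalPrefᵒᵈ ×ₗ ℕ ×ₗ List (𝕍 ×ₗ 𝕍)) ×ₗ Colex (Finset κ))

theorem PathWeight.key_eq_iff {x y : PathWeight 𝕍 κ} : x.key = y.key ↔ x.SameUpToComm y := by
  rcases x with _ | ⟨l, cs, p⟩ <;> rcases y with _ | ⟨m, ds, q⟩ <;>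
    simp [PathWeight.key, PathWeight.SameUpToComm, rank_inj]

theorem PathWeight.fullKey_injective :
    Function.Injective (PathWeight.fullKey : PathWeight 𝕍 κ → _) := by
  rintro (_ | ⟨l, cs, p⟩) (_ | ⟨m, ds, q⟩) h
  · rfl
  · simp [PathWeight.fullKey] at h
  · simp [PathWeight.fullKey] at h
  · simp only [PathWeight.fullKey, WithTop.coe_inj, toLex_inj, Prod.mk.injEq, rank_inj,
      toColex_inj] at h
    obtain ⟨⟨rfl, rfl⟩, rfl⟩ := h
    rfl

/-- The tie-break is reached only when the stored paths coincide, and then so do their deflations.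
-/
theorem PathWeight.choice_tie_irrelevant (tie tie' : Finset κ → Finset κ → Bool)
    {x y : PathWeight 𝕍 κ} (h : x = .invalid ∨ x.path ≠ y.path) :
    PathWeight.choice tie x y = PathWeight.choice tie' x y := by
  rcases x with _ | ⟨l, cs, p⟩ <;> rcases y with _ | ⟨m, ds, q⟩
  · rfl
  · rfl
  · rfl
  · have hne : rank l p ≠ rank m q := by
      rw [Ne, rank_inj]
      rintro ⟨-, rfl⟩
      rcases h with h | h
      · cases h
      · exact h rfl
    rw [PathWeight.choice_valid, PathWeight.choice_valid]
    rcases hne.lt_or_gt with h | h <;> simp [h, h.not_gt]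

theorem PathWeight.choice_sel (tie : Finset κ → Finset κ → Bool) (x y : PathWeight 𝕍 κ) :
    PathWeight.choice tie x y = x ∨ PathWeight.choice tie x y = y := by
  rcases x with _ | ⟨l, cs, p⟩ <;> rcases y with _ | ⟨m, ds, q⟩
  · exact Or.inl rfl
  · exact Or.inr rfl
  · exact Or.inl rfl
  · rw [PathWeight.choice_valid]
    split_ifs <;> simp

theorem PathWeight.choice_left_eq_argMin (x y : PathWeight 𝕍 κ) :
    PathWeight.choice (fun _ _ => true) x y = argMin PathWeight.key x y := by
  unfold argMin
  rcases x with _ | ⟨l, cs, p⟩ <;> rcases y with _ | ⟨m, ds, q⟩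
  · simp [PathWeight.choice]
  · simp [PathWeight.choice, PathWeight.key]
  · simp [PathWeight.choice, PathWeight.key]
  · rw [PathWeight.choice_valid]
    simp only [PathWeight.key, WithTop.coe_le_coe]
    rcases lt_trichotomy (rank l p) (rank m q) with h | h | h
    · simp [h, h.le]
    · simp [h]
    · simp [h, h.not_gt, h.not_ge]

theorem PathWeight.choice_colex_eq_argMin [LinearOrder κ] (x y : PathWeight 𝕍 κ) :
    PathWeight.choice (fun cs ds => decide (toColex cs ≤ toColex ds)) x y =
      argMin PathWeight.fullKey x y := by
  unfold argMin
  rcases x with _ | ⟨l, cs, p⟩ <;> rcases y with _ | ⟨m, ds, q⟩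
  · simp [PathWeight.choice]
  · simp [PathWeight.choice, PathWeight.fullKey]
  · simp [PathWeight.choice, PathWeight.fullKey]
  · rw [PathWeight.choice_valid]
    simp only [PathWeight.fullKey, WithTop.coe_le_coe, Prod.Lex.toLex_le_toLex]
    rcases lt_trichotomy (rank l p) (rank m q) with h | h | h
    · simp [h]
    · simp [h]
    · simp [h, h.not_gt, h.ne']

/-- On keys the choice is `min`, so the axioms hold up to equality of keys. An injective key gives
genuine equality; forgetting the communities gives `PathWeight.SameUpToComm`. -/
theorem isRoutingAlgebraUpTo_of_key {𝕍 : Type u} {A : RawRoutingAlgebra.{u, v} 𝕍} {L : Type*}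
    [LinearOrder L] (key : A.S → L) (hchoice : ∀ x y, A.choice x y = argMin key x y)
    (hzero : ∀ x, key A.zero ≤ key x) (hinf : ∀ x, key x ≤ key A.inf)
    (hfixed : ∀ i j, ∀ f ∈ A.E i j, f A.inf = A.inf)
    (hfInf : ∀ i j x, (A.fInf i j : A.S → A.S) x = A.inf) :
    IsRoutingAlgebraUpTo A (fun x y => key x = key y) where
  choice_sel x y := by
    simp only [hchoice, key_argMin]
    exact min_choice _ _
  choice_assoc x y z := by
    simp only [hchoice, key_argMin]
    exact (min_assoc _ _ _).symm
  choice_comm x y := by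
    simp only [hchoice, key_argMin]
    exact min_comm _ _
  zero_annihilator x := by
    simp only [hchoice, key_argMin]
    exact ⟨min_eq_right (hzero x), min_eq_left (hzero x)⟩
  inf_identity x := by
    simp only [hchoice, key_argMin]
    exact ⟨min_eq_left (hinf x), min_eq_right (hinf x)⟩
  inf_fixed i j f hf := congrArg key (hfixed i j f hf)
  fInf_inf i j x := congrArg key (hfInf i j x)

theorem bgpLiteWith_inf_fixed [DecidableEq κ] (tie : Finset κ → Finset κ → Bool) (i j : 𝕍)
    (f : PathWeight 𝕍 κ → PathWeight 𝕍 κ) (hf : f ∈ (bgpLiteWith 𝕍 κ tie).E i j) :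
    f .invalid = .invalid := by
  obtain ⟨pol, rfl⟩ := hf
  exact policyFunction_invalid i j pol

theorem bgpLiteWith_fInf [DecidableEq κ] (tie : Finset κ → Finset κ → Bool) (i j : 𝕍)
    (x : PathWeight 𝕍 κ) :
    ((bgpLiteWith 𝕍 κ tie).fInf i j).1 x = PathWeight.invalid := by
  change policyFunction i j .reject x = .invalid
  rcases x with _ | ⟨l, cs, p⟩
  · exact policyFunction_invalid i j _
  · simp [policyFunction, Policy.apply]

theorem isRoutingAlgebra_bgpLite [LinearOrder κ] : IsRoutingAlgebra (bgpLite 𝕍 κ) := by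
  have h := isRoutingAlgebraUpTo_of_key (A := bgpLite 𝕍 κ) PathWeight.fullKey
    PathWeight.choice_colex_eq_argMin ?_ (fun _ => le_top) (bgpLiteWith_inf_fixed _)
    (bgpLiteWith_fInf _)
  · have hr : (fun x y : PathWeight 𝕍 κ => x.fullKey = y.fullKey) = (fun x y => x = y) := by
      funext x y
      exact propext PathWeight.fullKey_injective.eq_iff
    rw [IsRoutingAlgebra]
    exact hr ▸ h
  · rintro (_ | ⟨l, cs, p⟩)
    · exact le_top
    · refine WithTop.coe_le_coe.2 (Prod.Lex.toLex_le_toLex'.2 ⟨rank_highest_nil_le l p, fun _ => ?_⟩)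
      -- The zero weight carries `∅`, the least community set.
      exact bot_le

theorem isRoutingAlgebraUpTo_bgpLiteLeft [DecidableEq κ] :
    IsRoutingAlgebraUpTo (bgpLiteLeft 𝕍 κ) PathWeight.SameUpToComm := by
  have h := isRoutingAlgebraUpTo_of_key (A := bgpLiteLeft 𝕍 κ) PathWeight.key
    PathWeight.choice_left_eq_argMin ?_ (fun _ => le_top) (bgpLiteWith_inf_fixed _)
    (bgpLiteWith_fInf _)
  · have hr : (fun x y : PathWeight 𝕍 κ => x.key = y.key) = PathWeight.SameUpToComm := by
      funext x y
      exact propext PathWeight.key_eq_iff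
    exact hr ▸ h
  · rintro (_ | ⟨l, cs, p⟩)
    · exact le_top
    · exact WithTop.coe_le_coe.2 (rank_highest_nil_le l p)

end Ranking

/-! ### The round does not depend on the tie-break. -/

section TieBreaking

variable {𝕍 : Type u} {κ : Type w} [LinearOrder 𝕍] [DecidableEq κ]

/-- Routes through different neighbours have different paths. -/
theorem IsPathAlgebra.path_eq {𝕍 : Type u} {A : RawRoutingAlgebra.{u, v} 𝕍}
    {path : A.S → Paths 𝕍} (hP : IsPathAlgebra A path) {i j : 𝕍} {f : A.S → A.S}
    (hf : f ∈ A.E i j) {x : A.S} (hx : f x ≠ A.inf) :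
    ∃ p : SimplePath 𝕍, path (f x) = p ∧ p.edges.head? = some (i, j) := by
  by_cases h : path x = ⊥
  · exact absurd ((hP.path_inf _).2 (hP.path_absent i j f hf x h)) hx
  · obtain ⟨p, hp⟩ := WithBot.ne_bot_iff_exists.1 h
    by_cases he : CanExtend i j p.edges
    · exact ⟨_, hP.path_accept i j f hf x p hp.symm he hx, rfl⟩
    · exact absurd ((hP.path_inf _).2 (hP.path_reject i j f hf x p hp.symm he)) hx

/-- Only the field `choice` depends on the tie-break, so `T` and `X` have the right types for both
algebras. Distinct neighbours give paths with distinct first edges, and the identity entry has the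
trivial path or none. -/
theorem F_tie_irrelevant (tie tie' : Finset κ → Finset κ → Bool) {V : Finset 𝕍}
    (T : Topology (bgpLiteWith 𝕍 κ tie) V) (X : State (bgpLiteWith 𝕍 κ tie) V) :
    F T X = F (A := bgpLiteWith 𝕍 κ tie') T X := by
  funext i j
  let g : V → PathWeight 𝕍 κ := fun k => (T i k).1 (X k j)
  have hg : ∀ k, g k ≠ .invalid →
      ∃ p : SimplePath 𝕍, (g k).path = p ∧ p.edges.head? = some ((i : 𝕍), (k : 𝕍)) :=
    fun k hk => (isPathAlgebra_bgpLiteWith tie).path_eq (T i k).2 hk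
  -- A partial sum is `invalid` or the offer of a later neighbour; without repetitions in `l` that
  -- neighbour is not the current one.
  have hsum : ∀ l : List V, l.Nodup →
      l.foldr (fun k x => PathWeight.choice tie (g k) x) .invalid =
      l.foldr (fun k x => PathWeight.choice tie' (g k) x) .invalid := by
    intro l
    induction l with
    | nil => exact fun _ => rfl
    | cons a l ih =>
      intro hl
      obtain ⟨hal, hl⟩ := List.nodup_cons.1 hl
      rw [List.foldr_cons, List.foldr_cons, ih hl]
      refine PathWeight.choice_tie_irrelevant tie tie' (or_iff_not_imp_left.2 fun ha hpath => ?_)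
      obtain ⟨p, hp, hpa⟩ := hg a ha
      rcases foldr_choice_mem (A := bgpLiteWith 𝕍 κ tie') (PathWeight.choice_sel tie') g l
        with h | ⟨k, hk, h⟩
      · rw [hp, show l.foldr (fun k x => PathWeight.choice tie' (g k) x) .invalid = .invalid
          from h] at hpath
        exact WithBot.coe_ne_bot hpath
      · rw [hp, show l.foldr (fun k x => PathWeight.choice tie' (g k) x) .invalid = g k
          from h] at hpath
        obtain ⟨q, hq, hqk⟩ := hg k fun h' => by
          rw [h'] at hpath
          exact WithBot.coe_ne_bot hpath
        obtain rfl : p = q := WithBot.coe_injective (hpath.trans hq)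
        rw [hpa] at hqk
        obtain rfl : a = k := Subtype.ext (by simpa using hqk)
        exact hal hk
  change PathWeight.choice tie (((Finset.univ : Finset V).sort (· ≤ ·)).foldr
      (fun k x => PathWeight.choice tie (g k) x) .invalid) (identity (bgpLiteWith 𝕍 κ tie) V i j) =
    PathWeight.choice tie' (((Finset.univ : Finset V).sort (· ≤ ·)).foldr
      (fun k x => PathWeight.choice tie' (g k) x) .invalid) (identity (bgpLiteWith 𝕍 κ tie) V i j)
  rw [hsum _ (Finset.sort_nodup _ _)]
  refine PathWeight.choice_tie_irrelevant tie tie' (or_iff_not_imp_left.2 fun hne hpath => ?_)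
  rcases foldr_choice_mem (A := bgpLiteWith 𝕍 κ tie') (PathWeight.choice_sel tie') g
    ((Finset.univ : Finset V).sort (· ≤ ·)) with h | ⟨k, -, h⟩
  · exact hne h
  · obtain ⟨p, hp, hpk⟩ := hg k (h ▸ hne)
    rw [show List.foldr (fun k x => PathWeight.choice tie' (g k) x) .invalid _ = g k from h,
      hp] at hpath
    unfold identity at hpath
    split_ifs at hpath
    · obtain rfl : p = SimplePath.nil := WithBot.coe_injective hpath
      simp [SimplePath.nil] at hpk
    · exact WithBot.coe_ne_bot hpath

theorem hull_tie_irrelevant (tie tie' : Finset κ → Finset κ → Bool) {V : Finset 𝕍}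
    (T : Topology (bgpLiteWith 𝕍 κ tie) V) (m : ℕ) :
    hull T m = hull (A := bgpLiteWith 𝕍 κ tie') T m := by
  induction m with
  | zero => rfl
  | succ m ih =>
    unfold hull
    rw [ih]
    simp only [F_tie_irrelevant tie tie']
    rfl

theorem alwaysConvergent_bgpLiteWith {κ : Type w} [LinearOrder κ]
    (tie : Finset κ → Finset κ → Bool) : AlwaysConvergent (bgpLiteWith 𝕍 κ tie) := by
  refine alwaysConvergent_of_hull_singleton ?_ (bgpLiteWith_fInf tie) fun V T => ?_
  · rintro (_ | _) <;> rfl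
  -- The boxes shrink in `bgpLite`, where `⊕` comes from a linear order, and they are the same boxes
  -- for `tie`.
  · obtain ⟨K, Y, h⟩ := exists_hull_singleton (A := bgpLite 𝕍 κ) isRoutingAlgebra_bgpLite
      (isPathAlgebra_bgpLiteWith _) (isIncreasing_bgpLiteWith _) T
    refine ⟨K, Y, fun i j => ?_⟩
    rw [hull_tie_irrelevant tie (fun cs ds => decide (toColex cs ≤ toColex ds)) T K]
    exact h i j

end TieBreaking

end DBF

theorem mainTheorem5 (𝕍 : Type*) (κ : Type*) [LinearOrder 𝕍] [LinearOrder κ] :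
    (DBF.IsRoutingAlgebra (DBF.bgpLite 𝕍 κ) ∧
      DBF.IsPathAlgebra (DBF.bgpLite 𝕍 κ) DBF.PathWeight.path ∧
      DBF.IsIncreasing (DBF.bgpLite 𝕍 κ) ∧
      DBF.AlwaysConvergent (DBF.bgpLite 𝕍 κ)) ∧
    (DBF.IsRoutingAlgebraUpTo (DBF.bgpLiteLeft 𝕍 κ) DBF.PathWeight.SameUpToComm ∧
      DBF.IsPathAlgebra (DBF.bgpLiteLeft 𝕍 κ) DBF.PathWeight.path ∧
      DBF.IsIncreasing (DBF.bgpLiteLeft 𝕍 κ) ∧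
      DBF.AlwaysConvergent (DBF.bgpLiteLeft 𝕍 κ)) ∧
    (∀ (l : DBF.LocalPref) (cs : Finset κ) (p : DBF.StoredPath 𝕍),
      (∀ n : ℕ, (DBF.PathWeight.valid l cs (p.inflate n)).path =
        (DBF.PathWeight.valid l cs p).path) ∧
      (∀ q : DBF.SimplePath 𝕍, p.edges = q.edges →
        (DBF.PathWeight.valid l cs p).path = (q : DBF.Paths 𝕍))) := by
  refine ⟨⟨DBF.isRoutingAlgebra_bgpLite, DBF.isPathAlgebra_bgpLiteWith _,
    DBF.isIncreasing_bgpLiteWith _, DBF.alwaysConvergent_bgpLiteWith _⟩,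
    ⟨DBF.isRoutingAlgebraUpTo_bgpLiteLeft, DBF.isPathAlgebra_bgpLiteWith _,
    DBF.isIncreasing_bgpLiteWith _, DBF.alwaysConvergent_bgpLiteWith _⟩, fun l cs p => ⟨fun n =>
      congrArg WithBot.some (p.deflate_inflate n), fun q hq => congrArg WithBot.some ?_⟩⟩
  refine DBF.SimplePath.ext ?_
  change DBF.deflate p.edges = q.edges
  rw [hq, DBF.deflate_eq_self q.contiguous q.nodup]
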